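/- Let $f,g:[0,1]\to[0,1]^2$ be continuous paths with $f(0)=(0,0)$, $f(1)=(1,1)$, $g(0)=(0,1)$, $g(1)=(1,0)$ such that $f(t)$ and $g(t)$ belong to the open unit square $(0,1)^2$ for all $0<t<1$. $B(x,r)$ denotes the open Euclidean ball. For $h\in\{f,g\}$, an open set $V\subseteq\mathbb R^2$ and a time $c$ with $h(c)\in V$, let $I^h_{V,c}$ be the longest open interval $I\subseteq[0,1]$ with $c\in I$ and $h(I)\subseteq V$. Let $Q$ be the following statement: there are rational numbers $a,r,s$ with $0<a<1$, $0<r<s$ and $\overline{B(f(a),s)}\subseteq(0,1)^2$ such that for every rational $t\in[r,s]$, where $I:=I^f_{B(f(a),t),a}$, we have $f(\inf I)\in\operatorname{range}(g)$ or $f(\sup I)\in\operatorname{range}(g)$. A *passage* is a pair $(V,c)$ where $c\in\mathbb Q\cap(0,1)$, $f(c)\in V$, and $V$ is either the open unit square $(0,1)^2$, or a ball $B(f(a),r)$ with $a\in\mathbb Q\cap(0,1)$, $r\in\mathbb Q$, $r>0$, and $\overline{B(f(a),r)}\subseteq(0,1)^2$, or the intersection of two such balls which meet and neither of which contains the other.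 A *gate* is a passage $(V,c)$ such that $f(\inf I^f_{V,c})\notin\operatorname{range}(g)$ and $f(\sup I^f_{V,c})\notin\operatorname{range}(g)$. A gate $(V,c)$ is *crossed by $g$* if there is a rational $d\in[0,1]$ with $g(d)\in V$ such that the straight line segment from $f(\inf I^f_{V,c})$ to $f(\sup I^f_{V,c})$ and the straight line segment from $g(\inf I^g_{V,d})$ to $g(\sup I^g_{V,d})$ intersect. Suppose that $Q$ does not hold, and let $(V,c)$ be a gate crossed by $g$. Then there is a gate $(V',c')$ crossed by $g$ such that $\overline{V'}\subseteq V$ and $\operatorname{diam}(V')<\operatorname{diam}(V)/2$. -/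

import Mathlib

open Set

/-- The Euclidean plane. -/
abbrev Plane : Type := EuclideanSpace ℝ (Fin 2)

/-- The open unit square `(0;1)²`. -/
def openSquare : Set Plane := {x | ∀ i, x i ∈ Ioo (0 : ℝ) 1}

/-- A continuous path in the closed unit square with parameter interval `[0;1]` which runs from `x`
to `y` and is in the open unit square at all times strictly between `0` and `1`. Only the values
of the function on `[0;1]` matter, here and in all definitions below. -/
structure IsSquarePath (h : ℝ → Plane) (x y : Plane) : Prop where
  continuousOn : ContinuousOn h (Icc 0 1)
  start_eq : h 0 = x
  end_eq : h 1 = y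
  mem_openSquare : ∀ t ∈ Ioo (0 : ℝ) 1, h t ∈ openSquare

/-- The range of a path with parameter interval `[0;1]`. -/
def pathRange (h : ℝ → Plane) : Set Plane := h '' Icc 0 1

/-- The open intervals `I` of times with `c ∈ I` and `h(I) ⊆ V`. -/
def visitIntervals (h : ℝ → Plane) (V : Set Plane) (c : ℝ) : Set (Set ℝ) :=
  {I | (∃ u v : ℝ, I = Ioo u v) ∧ I ⊆ Icc 0 1 ∧ c ∈ I ∧ MapsTo h I V}

/-- The longest open interval `I` of times with `c ∈ I` and `h(I) ⊆ V`, as the union of all of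
them. -/
def visitInterval (h : ℝ → Plane) (V : Set Plane) (c : ℝ) : Set ℝ :=
  ⋃₀ visitIntervals h V c

/-- If there is an open interval `I` with `c ∈ I` and `h(I) ⊆ V` at all, then `visitInterval` is
the longest one. -/
theorem visitInterval_isGreatest {h : ℝ → Plane} {V : Set Plane} {c : ℝ}
    (hne : (visitIntervals h V c).Nonempty) :
    IsGreatest (visitIntervals h V c) (visitInterval h V c) := by
  have hsub : visitInterval h V c ⊆ Icc 0 1 := sUnion_subset fun I hI => hI.2.1
  have hc : c ∈ visitInterval h V c := by
    obtain ⟨I, hI⟩ := hne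
    exact ⟨I, hI, hI.2.2.1⟩
  have hb : BddBelow (visitInterval h V c) := bddBelow_Icc.mono hsub
  have ha : BddAbove (visitInterval h V c) := bddAbove_Icc.mono hsub
  have hord : (visitInterval h V c).OrdConnected := by
    refine IsPreconnected.ordConnected ?_
    refine isPreconnected_sUnion c _ (fun I hI => hI.2.2.1) fun I hI => ?_
    obtain ⟨⟨u, v, rfl⟩, -⟩ := hI
    exact isPreconnected_Ioo
  have hopen : IsOpen (visitInterval h V c) := by
    refine isOpen_sUnion fun I hI => ?_
    obtain ⟨⟨u, v, rfl⟩, -⟩ := hI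
    exact isOpen_Ioo
  refine ⟨⟨⟨sInf (visitInterval h V c), sSup (visitInterval h V c), ?_⟩, hsub, hc, ?_⟩, ?_⟩
  · refine Subset.antisymm ?_ ?_
    · have hIcc : visitInterval h V c ⊆
          Icc (sInf (visitInterval h V c)) (sSup (visitInterval h V c)) :=
        fun y hy => ⟨csInf_le hb hy, le_csSup ha hy⟩
      simpa only [interior_Icc] using interior_maximal hIcc hopen
    · rintro x ⟨hx₁, hx₂⟩
      obtain ⟨y, hy, hyx⟩ := exists_lt_of_csInf_lt ⟨c, hc⟩ hx₁
      obtain ⟨z, hz, hxz⟩ := exists_lt_of_lt_csSup ⟨c, hc⟩ hx₂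
      exact hord.out hy hz ⟨hyx.le, hxz.le⟩
  · rintro x ⟨I, hI, hx⟩
    exact hI.2.2.2 hx
  · exact fun I hI => subset_sUnion_of_mem hI

/-- The left end point of the longest open interval `I` with `c ∈ I` and `h(I) ⊆ V`: going
backwards from time `c`, the time when `h` leaves `V`. -/
noncomputable def entryTime (h : ℝ → Plane) (V : Set Plane) (c : ℝ) : ℝ :=
  sInf (visitInterval h V c)

/-- The right end point of the longest open interval `I` with `c ∈ I` and `h(I) ⊆ V`: going
forwards from time `c`, the time when `h` leaves `V`. -/
noncomputable def exitTime (h : ℝ → Plane) (V : Set Plane) (c : ℝ) : ℝ :=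
  sSup (visitInterval h V c)

/-- The predicate `Q`: there are a rational time `a` and a nondegenerate interval `[r;s]` of radii
such that for each rational radius `t` in it one of the two points at which `f`, seen from time
`a`, leaves the open ball `B(f(a),t)` backwards and forwards is in the range of `g`. -/
def QPredicate (f g : ℝ → Plane) : Prop :=
  ∃ a r s : ℚ, (a : ℝ) ∈ Ioo 0 1 ∧ 0 < r ∧ r < s ∧
    closure (Metric.ball (f a) (s : ℝ)) ⊆ openSquare ∧
    ∀ t : ℚ, r ≤ t → t ≤ s →
      f (entryTime f (Metric.ball (f a) (t : ℝ)) a) ∈ pathRange g ∨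
      f (exitTime f (Metric.ball (f a) (t : ℝ)) a) ∈ pathRange g

/-- `V` is a ball `B(f(a),r)` with `a, r` rational whose closure is in the open unit square. -/
def IsPathBall (f : ℝ → Plane) (V : Set Plane) : Prop :=
  ∃ a r : ℚ, (a : ℝ) ∈ Ioo 0 1 ∧ 0 < r ∧
    closure (Metric.ball (f a) (r : ℝ)) ⊆ openSquare ∧ V = Metric.ball (f a) (r : ℝ)

/-- `V` is a lens: the strict intersection of two such balls, that is, the balls meet and neither
is contained in the other. -/
def IsPathLens (f : ℝ → Plane) (V : Set Plane) : Prop :=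
  ∃ B₁ B₂ : Set Plane, IsPathBall f B₁ ∧ IsPathBall f B₂ ∧
    ¬ B₁ ⊆ B₂ ∧ ¬ B₂ ⊆ B₁ ∧ (B₁ ∩ B₂).Nonempty ∧ V = B₁ ∩ B₂

/-- A passage of `f`: the open square, a ball or a lens, with a rational time when `f` is in it. -/
structure IsPassage (f : ℝ → Plane) (V : Set Plane) (c : ℚ) : Prop where
  shape : V = openSquare ∨ IsPathBall f V ∨ IsPathLens f V
  time_mem : (c : ℝ) ∈ Ioo 0 1
  mem : f c ∈ V

/-- A gate: a passage such that the points at which `f` enters and leaves are not in the range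
of `g`. -/
structure IsGate (f g : ℝ → Plane) (V : Set Plane) (c : ℚ) : Prop where
  isPassage : IsPassage f V c
  entry_notMem : f (entryTime f V c) ∉ pathRange g
  exit_notMem : f (exitTime f V c) ∉ pathRange g

/-- `(V,c)` is crossed by `g` via the rational time `d`: `g(d) ∈ V`, and the straight line segment
between the entry and the exit point of `f` around time `c` intersects the one between the entry
and the exit point of `g` around time `d`. -/
def IsCrossedVia (f g : ℝ → Plane) (V : Set Plane) (c d : ℚ) : Prop :=
  (d : ℝ) ∈ Icc 0 1 ∧ g d ∈ V ∧
    (segment ℝ (f (entryTime f V c)) (f (exitTime f V c)) ∩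
      segment ℝ (g (entryTime g V d)) (g (exitTime g V d))).Nonempty

/-- `(V,c)` is crossed by `g`. -/
def IsCrossed (f g : ℝ → Plane) (V : Set Plane) (c : ℚ) : Prop :=
  ∃ d : ℚ, IsCrossedVia f g V c d

/-! Attach to `f` on `[u;v]` and `g` on `[a;b]` the total logarithmic increment of `g t - f s`
around the boundary of the rectangle `[u;v] × [a;b]` (`crossingNumber`). It makes sense as soon as
the difference has no zero on that boundary, even if the paths meet inside, and it is additive in
`[u;v]`.

For excursions into a convex open set whose end points are in general position, the four increments
are principal logarithms, determined by the end points alone. They are angles of a quadrilateral,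
and their sum is nonzero if the diagonals intersect (`crossingNumber_ne_zero`). So the given crossed
gate has a nonzero number.

Suppose no smaller gate inside `V` is crossed. Fix the crossing excursion of `g`. Then every
excursion of `f` into a small ball or lens, with ends off `g`, contributes zero
(`crossingNumber_eq_zero_of_disjoint`). Since `Q` fails, such balls cover the excursion of `f` away
from its ends. Where two ball excursions overlap, the overlap is an excursion into a lens, so the
partial crossing number can be carried along a chain of balls (`exists_eq_of_cover`). Near its two
ends `f` stays in discs free of `g` and contributes zero as well. By additivity the whole number
vanishes, a contradiction. -/

/-! ### Continuous logarithms and their increments -/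

theorem Complex.eq_of_exp_eq_of_norm_sub_lt_pi {z w : ℂ} (h : Complex.exp z = Complex.exp w)
    (hzw : ‖z - w‖ < Real.pi) : z = w := by
  have h1 : Complex.exp (z - w) = Complex.exp 0 := by
    rw [Complex.exp_sub, h, div_self (Complex.exp_ne_zero _), Complex.exp_zero]
  have him := (Complex.abs_im_le_norm (z - w)).trans_lt hzw
  rw [abs_lt] at him
  have := Complex.exp_inj_of_neg_pi_lt_of_le_pi him.1 him.2.le
    (by simpa using Real.pi_pos) (by simpa using Real.pi_pos.le) h1
  exact sub_eq_zero.1 this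

/-- A continuous function on a compact set of reals with constant exponential, which takes the
same value at the two ends of each gap of the set, takes the same value at both ends of the set. -/
theorem eq_of_exp_eq_of_gaps {D : ℝ → ℂ} {T : Set ℝ} {a b : ℝ} (hT : IsClosed T)
    (hTab : T ⊆ Icc a b) (ha : a ∈ T) (hb : b ∈ T) (hD : ContinuousOn D T)
    (hexp : ∀ t ∈ T, Complex.exp (D t) = Complex.exp (D a))
    (hgap : ∀ u ∈ T, ∀ v ∈ T, u < v → (∀ t ∈ Ioo u v, t ∉ T) → D u = D v) : D a = D b := by
  -- Let `s` be the last point of `T` where `D` has its initial value. Values of `D` differ by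
  -- multiples of `2πi`, so by continuity `T` has no points just after `s`. The next point of `T`
  -- ends a gap, and `D` has the same value there.
  set S : Set ℝ := T ∩ D ⁻¹' {D a} with hS
  have hSc : IsClosed S := hD.preimage_isClosed_of_isClosed hT isClosed_singleton
  have haS : a ∈ S := ⟨ha, rfl⟩
  have hSb : BddAbove S := bddAbove_Icc.mono (inter_subset_left.trans hTab)
  have hs : sSup S ∈ S := hSc.csSup_mem ⟨a, haS⟩ hSb
  set s := sSup S with hs_def
  rcases (hTab hs.1).2.eq_or_lt with h | h
  · rw [← h]; exact hs.2.symm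
  exfalso
  have hcont := Metric.continuousWithinAt_iff.1 (hD s hs.1) Real.pi Real.pi_pos
  obtain ⟨δ, hδ, hcont⟩ := hcont
  have hlarge : ∀ t ∈ T, s < t → s + δ ≤ t := by
    intro t ht hst
    by_contra! hlt
    have h1 : dist t s < δ := by rw [Real.dist_eq, abs_lt]; constructor <;> linarith
    have h2 := hcont ht h1
    rw [dist_eq_norm] at h2
    have h3 := Complex.eq_of_exp_eq_of_norm_sub_lt_pi
      ((hexp t ht).trans (hexp s hs.1).symm) h2
    have h4 : t ∈ S := ⟨ht, h3.trans hs.2⟩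
    exact absurd (le_csSup hSb h4) (not_le.2 hst)
  have hUc : IsClosed (T ∩ Ici (s + δ)) := hT.inter isClosed_Ici
  have hUb : BddBelow (T ∩ Ici (s + δ)) := ⟨s + δ, fun x hx => hx.2⟩
  have hv := hUc.csInf_mem ⟨b, hb, hlarge b hb h⟩ hUb
  set v := sInf (T ∩ Ici (s + δ)) with hv_def
  have hsv : s < v := by
    have : s + δ ≤ v := hv.2
    linarith
  have hDv := hgap s hs.1 v hv.1 hsv fun t ht htT =>
    absurd (csInf_le hUb ⟨htT, hlarge t htT ht.1⟩) (not_le.2 ht.2)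
  have h4 : v ∈ S := ⟨hv.1, hDv.symm.trans hs.2⟩
  exact absurd (le_csSup hSb h4) (not_le.2 hsv)

/-- `θ` is a continuous logarithm of `h` on `[a;b]`. -/
structure IsLogOn (θ h : ℝ → ℂ) (a b : ℝ) : Prop where
  continuousOn : ContinuousOn θ (Icc a b)
  exp_eq : ∀ t ∈ Icc a b, Complex.exp (θ t) = h t

/-- The difference of two logarithms has exponential 1, and an interval has no gaps, so the
difference is the same at both ends. -/
theorem IsLogOn.sub_eq_sub {θ₁ θ₂ h : ℝ → ℂ} {a b : ℝ} (hab : a ≤ b) (h₁ : IsLogOn θ₁ h a b)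
    (h₂ : IsLogOn θ₂ h a b) : θ₁ b - θ₁ a = θ₂ b - θ₂ a := by
  have hexp : ∀ t ∈ Icc a b, Complex.exp (θ₁ t - θ₂ t) = 1 := fun t ht => by
    rw [Complex.exp_sub, h₁.exp_eq t ht, ← h₂.exp_eq t ht, div_self (Complex.exp_ne_zero _)]
  have := eq_of_exp_eq_of_gaps (D := fun t => θ₁ t - θ₂ t) isClosed_Icc Subset.rfl
    (left_mem_Icc.2 hab) (right_mem_Icc.2 hab) (h₁.continuousOn.sub h₂.continuousOn)
    (fun t ht => by rw [hexp t ht, hexp a (left_mem_Icc.2 hab)])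
    (fun u hu v hv huv hgap => by
      obtain ⟨t, ht⟩ := nonempty_Ioo.2 huv
      exact absurd ⟨hu.1.trans ht.1.le, ht.2.le.trans hv.2⟩ (hgap t ht))
  linear_combination -this

/-- Path lifting for the covering `exp`, after extending `h` to the whole line by constants. -/
theorem exists_isLogOn {h : ℝ → ℂ} {a b : ℝ} (hab : a ≤ b) (hc : ContinuousOn h (Icc a b))
    (h0 : ∀ t ∈ Icc a b, h t ≠ 0) : ∃ θ, IsLogOn θ h a b := by
  have hcont : Continuous (IccExtend hab ((Icc a b).domRestrict h)) :=
    (continuousOn_iff_continuous_domRestrict.1 hc).Icc_extend'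
  have hne : ∀ t, IccExtend hab ((Icc a b).domRestrict h) t ∈ ({0}ᶜ : Set ℂ) := fun t =>
    h0 _ (projIcc a b hab t).2
  obtain ⟨F, ⟨-, hF⟩, -⟩ := Complex.isCoveringMapOn_exp.existsUnique_continuousMap_lifts
    ⟨_, hcont⟩ (a₀ := a) (Complex.exp_log (hne a)) hne
  refine ⟨F, F.continuous.continuousOn, fun t ht => ?_⟩
  exact (congrFun hF t).trans (IccExtend_of_mem hab ((Icc a b).domRestrict h) ht)

/-- The increment from `a` to `b` of a continuous logarithm of `h` on `[a;b]`. -/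
noncomputable def logIncrement (h : ℝ → ℂ) (a b : ℝ) : ℂ :=
  Classical.epsilon fun z => ∃ θ, IsLogOn θ h a b ∧ z = θ b - θ a

theorem IsLogOn.logIncrement_eq {θ h : ℝ → ℂ} {a b : ℝ} (hab : a ≤ b) (hθ : IsLogOn θ h a b) :
    logIncrement h a b = θ b - θ a := by
  obtain ⟨θ', hθ', h'⟩ := Classical.epsilon_spec
    (p := fun z => ∃ θ, IsLogOn θ h a b ∧ z = θ b - θ a) ⟨_, θ, hθ, rfl⟩
  exact h'.trans (hθ'.sub_eq_sub hab hθ)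

theorem IsLogOn.mono {θ h : ℝ → ℂ} {a b u v : ℝ} (hθ : IsLogOn θ h a b) (hu : a ≤ u)
    (hv : v ≤ b) : IsLogOn θ h u v :=
  ⟨hθ.continuousOn.mono (Icc_subset_Icc hu hv), fun t ht =>
    hθ.exp_eq t ⟨hu.trans ht.1, ht.2.trans hv⟩⟩

theorem logIncrement_add {h : ℝ → ℂ} {a b c : ℝ} (hab : a ≤ b) (hbc : b ≤ c)
    (hc : ContinuousOn h (Icc a c)) (h0 : ∀ t ∈ Icc a c, h t ≠ 0) :
    logIncrement h a b + logIncrement h b c = logIncrement h a c := by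
  obtain ⟨θ, hθ⟩ := exists_isLogOn (hab.trans hbc) hc h0
  rw [hθ.logIncrement_eq (hab.trans hbc), (hθ.mono le_rfl hbc).logIncrement_eq hab,
    (hθ.mono hab le_rfl).logIncrement_eq hbc]
  ring

/-- As long as the ratio to the initial value avoids the cut, its principal logarithm is itself a
continuous branch. -/
theorem logIncrement_eq_log {h : ℝ → ℂ} {a b : ℝ} (hab : a ≤ b) (hc : ContinuousOn h (Icc a b))
    (h0 : ∀ t ∈ Icc a b, h t / h a ∈ Complex.slitPlane) :
    logIncrement h a b = Complex.log (h b / h a) := by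
  have ha : h a ≠ 0 := by
    intro h1
    simpa [h1] using h0 a (left_mem_Icc.2 hab)
  have hθ : IsLogOn (fun t => Complex.log (h t / h a) + Complex.log (h a)) h a b := by
    refine ⟨((hc.div_const _).clog h0).add continuousOn_const, fun t ht => ?_⟩
    rw [Complex.exp_add, Complex.exp_log ha, Complex.exp_log (Complex.slitPlane_ne_zero (h0 t ht)),
      div_mul_cancel₀ _ ha]
  rw [hθ.logIncrement_eq hab, div_self ha, Complex.log_one]
  ring

/-! ### Angles in quadrilaterals -/

theorem Complex.log_div_of_re_pos {z w : ℂ} (hz : 0 < z.re) (hw : 0 < w.re) :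
    Complex.log (z / w) = Complex.log z - Complex.log w := by
  have hz0 : z ≠ 0 := by rintro rfl; simp at hz
  have hw0 : w ≠ 0 := by rintro rfl; simp at hw
  have h1 := abs_lt.1 (Complex.abs_arg_lt_pi_div_two_iff.2 (Or.inl hz))
  have h2 := abs_lt.1 (Complex.abs_arg_lt_pi_div_two_iff.2 (Or.inl hw))
  rw [← Complex.log_exp (x := Complex.log z - Complex.log w), Complex.exp_sub,
    Complex.exp_log hz0, Complex.exp_log hw0]
  all_goals
    simp only [Complex.sub_im, Complex.log_im]
    linarith

/-- An identity between the logarithms of the four ratios of the differences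
of the end points of two disjoint segments. -/
theorem log_quadrilateral {y₀ y₁ p q : ℂ} (h : Disjoint (segment ℝ p q) (segment ℝ y₀ y₁)) :
    Complex.log ((y₁ - q) / (y₀ - q)) - Complex.log ((y₁ - p) / (y₀ - p)) =
      Complex.log ((y₁ - q) / (y₁ - p)) - Complex.log ((y₀ - q) / (y₀ - p)) := by
  have hcomp : ∀ x y : ℂ, IsCompact (segment ℝ x y) := fun x y => by
    rw [← convexHull_pair]; exact (Set.toFinite _).isCompact_convexHull ℝ
  obtain ⟨f, u, v, hu, huv, hv⟩ := geometric_hahn_banach_compact_closed (convex_segment p q)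
    (hcomp p q) (convex_segment y₀ y₁) (hcomp y₀ y₁).isClosed h
  -- The separating functional is `z ↦ Re (c * z)`. Multiplication by `c` thus moves all four
  -- differences into the right half plane, where the logarithm of a quotient splits.
  set c : ℂ := f 1 - f Complex.I * Complex.I with hcdef
  have hf : ∀ z, (c * z).re = f z := by
    intro z
    have : z = z.re • (1 : ℂ) + z.im • Complex.I := by
      simp [Complex.re_add_im]
    conv_rhs => rw [this, map_add, map_smul, map_smul]
    simp [hcdef]
    ring
  have hc : c ≠ 0 := by
    intro h0
    have h1 := hf y₀
    have h2 := hf p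
    rw [h0, zero_mul, Complex.zero_re] at h1 h2
    have h3 := hu p (left_mem_segment ℝ _ _)
    have h4 := hv y₀ (left_mem_segment ℝ _ _)
    linarith
  have hpos : ∀ x ∈ segment ℝ p q, ∀ y ∈ segment ℝ y₀ y₁, 0 < (c * (y - x)).re := by
    intro x hx y hy
    rw [hf, map_sub]
    linarith [hu x hx, hv y hy]
  have hdiv : ∀ z w : ℂ, z / w = c * z / (c * w) := fun z w => (mul_div_mul_left z w hc).symm
  have hp := left_mem_segment ℝ p q
  have hq := right_mem_segment ℝ p q
  have h0 := left_mem_segment ℝ y₀ y₁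
  have h1 := right_mem_segment ℝ y₀ y₁
  rw [hdiv (y₁ - q), hdiv (y₁ - p), hdiv (y₁ - q), hdiv (y₀ - q),
    Complex.log_div_of_re_pos (hpos q hq _ h1) (hpos q hq _ h0),
    Complex.log_div_of_re_pos (hpos p hp _ h1) (hpos p hp _ h0),
    Complex.log_div_of_re_pos (hpos q hq _ h1) (hpos p hp _ h1),
    Complex.log_div_of_re_pos (hpos q hq _ h0) (hpos p hp _ h0)]
  ring

/-- A nonpositive real ratio means that `y` and `z` lie on opposite sides of `p` on a line, or that
`p` is an end point. -/
theorem div_mem_slitPlane {p y z : ℂ} (h : p ∉ segment ℝ y z) :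
    (z - p) / (y - p) ∈ Complex.slitPlane := by
  by_contra hn
  rw [Complex.mem_slitPlane_iff] at hn
  push Not at hn
  have hyp : y - p ≠ 0 := by
    intro h0
    exact h ((sub_eq_zero.1 h0) ▸ left_mem_segment ℝ _ _)
  set r := ((z - p) / (y - p)).re with hr
  have hz : z - p = r * (y - p) := by
    rw [← div_eq_iff hyp]
    apply Complex.ext <;> simp [hr, hn.2]
  have hr1 : (0 : ℝ) < 1 - r := by linarith
  refine h ⟨-r / (1 - r), 1 / (1 - r), div_nonneg (by linarith) hr1.le, by positivity, ?_, ?_⟩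
  · field_simp
    ring
  · have hr2 : (1 - r : ℂ) ≠ 0 := by exact_mod_cast hr1.ne'
    have hz' : z = p + r * (y - p) := by rw [← hz]; ring
    rw [hz']
    simp only [Complex.real_smul]
    push_cast
    field_simp
    ring

theorem Complex.arg_div_pos {z w : ℂ} (h : 0 < w.re * z.im - w.im * z.re) :
    0 < (z / w).arg := by
  have hw : w ≠ 0 := by rintro rfl; simp at h
  have him : 0 < (z / w).im := by
    rw [Complex.div_im, ← sub_div]
    exact div_pos (by linarith) (Complex.normSq_pos.2 hw)
  refine lt_of_le_of_ne (Complex.arg_nonneg_iff.2 him.le) fun h0 => ?_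
  exact him.ne' (Complex.arg_eq_zero_iff.1 h0.symm).2

theorem Complex.arg_div_neg {z w : ℂ} (h : w.re * z.im - w.im * z.re < 0) :
    (z / w).arg < 0 := by
  have hw : w ≠ 0 := by rintro rfl; simp at h
  rw [Complex.arg_neg_iff, Complex.div_im, ← sub_div]
  exact div_neg_of_neg_of_pos (by linarith) (Complex.normSq_pos.2 hw)

theorem add_smul_mem_segment {o w : ℂ} {a b t : ℝ} (hab : a + b = 1) (h₁ : -b ≤ t) (h₂ : t ≤ a) :
    o + t * w ∈ segment ℝ (o - b * w) (o + a * w) := by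
  refine ⟨a - t, b + t, by linarith, by linarith, by linarith, ?_⟩
  obtain rfl : a = 1 - b := by linarith
  simp only [Complex.real_smul]
  push_cast
  ring

/-- The sum of the oriented interior angles of a quadrilateral does not vanish if its diagonals
intersect. -/
theorem log_quadrilateral_ne_zero {p q y₀ y₁ : ℂ}
    (h : (segment ℝ p q ∩ segment ℝ y₀ y₁).Nonempty) (hp : p ∉ segment ℝ y₀ y₁)
    (hq : q ∉ segment ℝ y₀ y₁) (h₀ : y₀ ∉ segment ℝ p q) (h₁ : y₁ ∉ segment ℝ p q) :
    Complex.log ((y₁ - q) / (y₀ - q)) - Complex.log ((y₁ - p) / (y₀ - p)) -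
      Complex.log ((q - y₁) / (p - y₁)) + Complex.log ((q - y₀) / (p - y₀)) ≠ 0 := by
  obtain ⟨o, ho₁, ho₂⟩ := h
  obtain ⟨a, b, ha, hb, hab, ho⟩ := id ho₁
  obtain ⟨c, d, hc, hd, hcd, ho'⟩ := id ho₂
  simp only [Complex.real_smul] at ho ho'
  have habC : (a : ℂ) + b = 1 := by exact_mod_cast hab
  have hcdC : (c : ℂ) + d = 1 := by exact_mod_cast hcd
  obtain ⟨u, hu⟩ : ∃ u, u = q - p := ⟨_, rfl⟩
  obtain ⟨v, hv⟩ : ∃ v, v = y₁ - y₀ := ⟨_, rfl⟩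
  have ep : p = o - b * u := by
    rw [hu, ← ho]; linear_combination -p * habC
  have eq : q = o + a * u := by
    rw [hu, ← ho]; linear_combination -q * habC
  have e0 : y₀ = o - d * v := by
    rw [hv, ← ho']; linear_combination -y₀ * hcdC
  have e1 : y₁ = o + c * v := by
    rw [hv, ← ho']; linear_combination -y₁ * hcdC
  clear ho ho' hu hv
  have ha' : 0 < a := lt_of_le_of_ne ha fun h => hq (by rw [eq, ← h]; simpa using ho₂)
  have hb' : 0 < b := lt_of_le_of_ne hb fun h => hp (by rw [ep, ← h]; simpa using ho₂)
  have hc' : 0 < c := lt_of_le_of_ne hc fun h => h₁ (by rw [e1, ← h]; simpa using ho₁)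
  have hd' : 0 < d := lt_of_le_of_ne hd fun h => h₀ (by rw [e0, ← h]; simpa using ho₁)
  clear ho₁ ho₂
  -- `D` is the cross product of the diagonals. If it vanishes, both segments lie on one line
  -- through the common point `o`, and some end point of one lies in the other.
  obtain ⟨D, hD⟩ : ∃ D, D = u.re * v.im - u.im * v.re := ⟨_, rfl⟩
  have hD0 : D ≠ 0 := by
    intro h0
    have hu0 : u ≠ 0 := by
      rintro rfl
      refine hp ⟨c, d, hc, hd, hcd, ?_⟩
      rw [e0, e1, ep]
      simp only [Complex.real_smul]
      linear_combination o * hcdC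
    obtain ⟨r, rfl⟩ : ∃ r : ℝ, v = r * u := by
      have hn : u.re ^ 2 + u.im ^ 2 ≠ 0 := by
        intro h
        apply hu0
        apply Complex.ext <;> simp <;> nlinarith [sq_nonneg u.re, sq_nonneg u.im]
      refine ⟨(u.re * v.re + u.im * v.im) / (u.re ^ 2 + u.im ^ 2), ?_⟩
      rw [h0] at hD
      apply Complex.ext
      · simp only [Complex.mul_re, Complex.ofReal_re, Complex.ofReal_im]
        field_simp
        linear_combination u.im * hD
      · simp only [Complex.mul_im, Complex.ofReal_re, Complex.ofReal_im]
        field_simp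
        linear_combination -u.re * hD
    have hmem : ∀ t : ℝ, -b ≤ t → t ≤ a → o + t * u ∈ segment ℝ p q := fun t h h' => by
      rw [ep, eq]; exact add_smul_mem_segment hab h h'
    have hmem' : ∀ t : ℝ, -d ≤ t → t ≤ c → o + t * (r * u) ∈ segment ℝ y₀ y₁ := fun t h h' => by
      rw [e0, e1]; exact add_smul_mem_segment hcd h h'
    have hq' : r ≠ 0 → -d ≤ a / r → a / r ≤ c → False := fun hr h h' => hq <| by
      have := hmem' _ h h'
      rwa [← mul_assoc, ← Complex.ofReal_mul, div_mul_cancel₀ _ hr, ← eq] at this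
    -- In the coordinate along `u` with origin `o`, the ends `p`, `q`, `y₀`, `y₁` are at `-b`, `a`,
    -- `-d * r`, `c * r`. On the positive side, the nearer of the two ends lies in the other
    -- segment.
    rcases le_or_gt 0 r with hr | hr
    · rcases le_or_gt (c * r) a with h | h
      · refine h₁ ?_
        have := hmem (c * r) (by nlinarith) h
        rwa [Complex.ofReal_mul, mul_assoc, ← e1] at this
      · have hr' : 0 < r := by nlinarith
        refine hq' hr'.ne' ?_ ?_
        · have := div_pos ha' hr'; linarith
        · rw [div_le_iff₀ hr']; exact h.le
    · rcases le_or_gt (-d * r) a with h | h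
      · refine h₀ ?_
        have := hmem (-d * r) (by nlinarith) h
        rwa [Complex.ofReal_mul, mul_assoc, Complex.ofReal_neg, neg_mul, ← sub_eq_add_neg,
          ← e0] at this
      · refine hq' hr.ne ?_ ?_
        · rw [le_div_iff_of_neg hr]; exact h.le
        · have := div_neg_of_pos_of_neg ha' hr; linarith
  -- With the signs they carry in the sum, the four angles all have the sign of `-D`, so they cannot
  -- cancel.
  have c1 : (y₀ - q).re * (y₁ - q).im - (y₀ - q).im * (y₁ - q).re = -a * D := by
    obtain rfl : d = 1 - c := by linarith
    rw [eq, e0, e1, hD]; simp; ring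
  have c2 : (y₀ - p).re * (y₁ - p).im - (y₀ - p).im * (y₁ - p).re = b * D := by
    obtain rfl : d = 1 - c := by linarith
    rw [ep, e0, e1, hD]; simp; ring
  have c3 : (p - y₁).re * (q - y₁).im - (p - y₁).im * (q - y₁).re = c * D := by
    obtain rfl : b = 1 - a := by linarith
    rw [ep, eq, e1, hD]; simp; ring
  have c4 : (p - y₀).re * (q - y₀).im - (p - y₀).im * (q - y₀).re = -d * D := by
    obtain rfl : b = 1 - a := by linarith
    rw [ep, eq, e0, hD]; simp; ring
  intro h
  have h := congrArg Complex.im h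
  simp only [Complex.add_im, Complex.sub_im, Complex.log_im, Complex.zero_im] at h
  rcases lt_or_gt_of_ne hD0 with hD1 | hD1
  · linarith [Complex.arg_div_pos (c1 ▸ mul_pos_of_neg_of_neg (neg_neg_of_pos ha') hD1),
      Complex.arg_div_neg (c2 ▸ mul_neg_of_pos_of_neg hb' hD1),
      Complex.arg_div_neg (c3 ▸ mul_neg_of_pos_of_neg hc' hD1),
      Complex.arg_div_pos (c4 ▸ mul_pos_of_neg_of_neg (neg_neg_of_pos hd') hD1)]
  · linarith [Complex.arg_div_neg (c1 ▸ mul_neg_of_neg_of_pos (neg_neg_of_pos ha') hD1),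
      Complex.arg_div_pos (c2 ▸ mul_pos hb' hD1), Complex.arg_div_pos (c3 ▸ mul_pos hc' hD1),
      Complex.arg_div_neg (c4 ▸ mul_neg_of_neg_of_pos (neg_neg_of_pos hd') hD1)]

/-! ### Transfer to the complex plane -/

/-- The plane, as the complex numbers. -/
noncomputable def planeToComplex : Plane ≃ₗᵢ[ℝ] ℂ :=
  Complex.orthonormalBasisOneI.repr.symm

theorem planeToComplex_mem_segment {x y z : Plane} :
    planeToComplex x ∈ segment ℝ (planeToComplex y) (planeToComplex z) ↔ x ∈ segment ℝ y z := by
  have h : planeToComplex '' segment ℝ y z = segment ℝ (planeToComplex y) (planeToComplex z) :=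
    image_segment ℝ planeToComplex.toLinearEquiv.toLinearMap.toAffineMap y z
  rw [← h]
  exact planeToComplex.injective.mem_set_image

theorem planeToComplex_sub_ne_zero {x y : Plane} (h : x ≠ y) : planeToComplex (x - y) ≠ 0 :=
  planeToComplex.map_ne_zero_iff.2 (sub_ne_zero.2 h)

theorem planeToComplex_div_mem_slitPlane {x y z : Plane} (h : x ∉ segment ℝ y z) :
    planeToComplex (z - x) / planeToComplex (y - x) ∈ Complex.slitPlane := by
  rw [map_sub, map_sub]
  exact div_mem_slitPlane fun h' => h (planeToComplex_mem_segment.1 h')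

theorem planeToComplex_div_swap (x y z : Plane) :
    planeToComplex (x - y) / planeToComplex (x - z) =
      planeToComplex (y - x) / planeToComplex (z - x) := by
  rw [← neg_sub y x, ← neg_sub z x, map_neg, map_neg, neg_div_neg_eq]

theorem continuousOn_planeToComplex_sub {h : ℝ → Plane} {s : Set ℝ} (hc : ContinuousOn h s)
    (x : Plane) : ContinuousOn (fun t => planeToComplex (h t - x)) s :=
  planeToComplex.continuous.comp_continuousOn (hc.sub continuousOn_const)

theorem logIncrement_planeToComplex {h : ℝ → Plane} {x : Plane} {a b : ℝ} (hab : a ≤ b)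
    (hc : ContinuousOn h (Icc a b)) (hx : ∀ t ∈ Icc a b, x ∉ segment ℝ (h a) (h t)) :
    logIncrement (fun t => planeToComplex (h t - x)) a b =
      Complex.log (planeToComplex (h b - x) / planeToComplex (h a - x)) :=
  logIncrement_eq_log hab (continuousOn_planeToComplex_sub hc x) fun t ht =>
    planeToComplex_div_mem_slitPlane (hx t ht)

/-! ### The crossing number -/

/-- The algebraic number (up to the factor `2πi`) of the crossings of `f` on `[u;v]` and `g` on
`[a;b]`. -/
noncomputable def crossingNumber (f g : ℝ → Plane) (u v a b : ℝ) : ℂ :=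
  logIncrement (fun t => planeToComplex (g t - f v)) a b -
    logIncrement (fun t => planeToComplex (g t - f u)) a b -
    logIncrement (fun s => planeToComplex (f s - g b)) u v +
    logIncrement (fun s => planeToComplex (f s - g a)) u v

/-- The increments of `g` seen from `f v` cancel along the common side of the two rectangles. -/
theorem crossingNumber_add {f g : ℝ → Plane} {u v w a b : ℝ} (huv : u ≤ v) (hvw : v ≤ w)
    (hf : ContinuousOn f (Icc u w)) (ha : ∀ s ∈ Icc u w, f s ≠ g a)
    (hb : ∀ s ∈ Icc u w, f s ≠ g b) :
    crossingNumber f g u v a b + crossingNumber f g v w a b = crossingNumber f g u w a b := by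
  have h1 := logIncrement_add huv hvw (continuousOn_planeToComplex_sub hf (g a))
    fun t ht => planeToComplex_sub_ne_zero (ha t ht)
  have h2 := logIncrement_add huv hvw (continuousOn_planeToComplex_sub hf (g b))
    fun t ht => planeToComplex_sub_ne_zero (hb t ht)
  unfold crossingNumber
  rw [← h1, ← h2]
  ring

/-- The difference of the angles at which a path is seen from two points, if at the times in `T`
the path is not between them, and in the gaps of `T` it does not cross between them. -/
theorem logIncrement_sub_logIncrement {g : ℝ → Plane} {p q : Plane} {a b : ℝ} {T : Set ℝ}
    (hg : ContinuousOn g (Icc a b)) (hp : ∀ t ∈ Icc a b, g t ≠ p) (hq : ∀ t ∈ Icc a b, g t ≠ q)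
    (hT : IsClosed T) (hTab : T ⊆ Icc a b) (haT : a ∈ T) (hbT : b ∈ T)
    (hpq : ∀ t ∈ T, g t ∉ segment ℝ p q)
    (hgap : ∀ u ∈ T, ∀ v ∈ T, u < v → (∀ t ∈ Ioo u v, t ∉ T) →
      (∀ t ∈ Icc u v, p ∉ segment ℝ (g u) (g t)) ∧ (∀ t ∈ Icc u v, q ∉ segment ℝ (g u) (g t)) ∧
      Disjoint (segment ℝ p q) (segment ℝ (g u) (g v))) :
    logIncrement (fun t => planeToComplex (g t - q)) a b -
      logIncrement (fun t => planeToComplex (g t - p)) a b =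
    Complex.log (planeToComplex (g b - q) / planeToComplex (g b - p)) -
      Complex.log (planeToComplex (g a - q) / planeToComplex (g a - p)) := by
  have hab : a ≤ b := (hTab haT).2
  obtain ⟨θ, hθ⟩ := exists_isLogOn hab (continuousOn_planeToComplex_sub hg p)
    fun t ht => planeToComplex_sub_ne_zero (hp t ht)
  obtain ⟨η, hη⟩ := exists_isLogOn hab (continuousOn_planeToComplex_sub hg q)
    fun t ht => planeToComplex_sub_ne_zero (hq t ht)
  rw [hθ.logIncrement_eq hab, hη.logIncrement_eq hab]
  have hslit : ∀ t ∈ T, planeToComplex (g t - q) / planeToComplex (g t - p) ∈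
      Complex.slitPlane := fun t ht => by
    rw [planeToComplex_div_swap]
    exact planeToComplex_div_mem_slitPlane (hpq t ht)
  have hexp : ∀ t ∈ T, Complex.exp (η t - θ t -
      Complex.log (planeToComplex (g t - q) / planeToComplex (g t - p))) = 1 := fun t ht => by
    rw [Complex.exp_sub, Complex.exp_sub, hη.exp_eq t (hTab ht), hθ.exp_eq t (hTab ht),
      Complex.exp_log (Complex.slitPlane_ne_zero (hslit t ht)),
      div_self (Complex.slitPlane_ne_zero (hslit t ht))]
  -- On `T` the principal logarithm of the ratio is continuous and differs from `η - θ` by a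
  -- multiple of `2πi`. Across a gap both change equally, by `log_quadrilateral`.
  have key := eq_of_exp_eq_of_gaps (D := fun t => η t - θ t -
      Complex.log (planeToComplex (g t - q) / planeToComplex (g t - p))) hT hTab haT hbT
    (((hη.continuousOn.mono hTab).sub (hθ.continuousOn.mono hTab)).sub
      (ContinuousOn.clog (((continuousOn_planeToComplex_sub hg q).mono hTab).div
        ((continuousOn_planeToComplex_sub hg p).mono hTab)
        fun t ht => planeToComplex_sub_ne_zero (hp t (hTab ht))) hslit))
    (fun t ht => by rw [hexp t ht, hexp a haT]) ?_
  · linear_combination -key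
  · intro u hu v hv huv hg'
    obtain ⟨h1, h2, h3⟩ := hgap u hu v hv huv hg'
    have hua := (hTab hu).1
    have hvb := (hTab hv).2
    have e1 := logIncrement_planeToComplex huv.le (hg.mono (Icc_subset_Icc hua hvb)) h1
    have e2 := logIncrement_planeToComplex huv.le (hg.mono (Icc_subset_Icc hua hvb)) h2
    rw [(hθ.mono hua hvb).logIncrement_eq huv.le] at e1
    rw [(hη.mono hua hvb).logIncrement_eq huv.le] at e2
    have h3' : Disjoint (segment ℝ (planeToComplex p) (planeToComplex q))
        (segment ℝ (planeToComplex (g u)) (planeToComplex (g v))) := by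
      rw [Set.disjoint_left] at h3 ⊢
      intro x hx hx'
      obtain ⟨x, rfl⟩ := planeToComplex.surjective x
      exact h3 (planeToComplex_mem_segment.1 hx) (planeToComplex_mem_segment.1 hx')
    have e3 := log_quadrilateral h3'
    simp only [← map_sub] at e3
    linear_combination e1 - e2 - e3

theorem logIncrement_planeToComplex' {f : ℝ → Plane} {y : Plane} {u v : ℝ} {C : Set Plane}
    (huv : u ≤ v) (hf : ContinuousOn f (Icc u v)) (hC : Convex ℝ C) (hfC : MapsTo f (Icc u v) C)
    (hy : y ∉ C) : logIncrement (fun s => planeToComplex (f s - y)) u v =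
      Complex.log (planeToComplex (y - f v) / planeToComplex (y - f u)) := by
  rw [planeToComplex_div_swap]
  exact logIncrement_planeToComplex huv hf fun t ht h =>
    hy (hC.segment_subset (hfC (left_mem_Icc.2 huv)) (hfC ht) h)

/-- No point of `g` lies on a segment between points of `f`, so every increment is given by
principal logarithms, and these cancel. Here `T` is the whole interval and has no gaps. -/
theorem crossingNumber_eq_zero_of_convex {f g : ℝ → Plane} {u v a b : ℝ} {C : Set Plane}
    (huv : u ≤ v) (hab : a ≤ b) (hf : ContinuousOn f (Icc u v)) (hg : ContinuousOn g (Icc a b))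
    (hC : Convex ℝ C) (hfC : MapsTo f (Icc u v) C) (hgC : ∀ t ∈ Icc a b, g t ∉ C) :
    crossingNumber f g u v a b = 0 := by
  have hu := hfC (left_mem_Icc.2 huv)
  have hv := hfC (right_mem_Icc.2 huv)
  have h1 := logIncrement_sub_logIncrement (p := f u) (q := f v) hg
    (fun t ht h => hgC t ht (h ▸ hu)) (fun t ht h => hgC t ht (h ▸ hv)) isClosed_Icc Subset.rfl
    (left_mem_Icc.2 hab) (right_mem_Icc.2 hab)
    (fun t ht h => hgC t ht (hC.segment_subset hu hv h))
    (fun x hx y hy hxy hgap => by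
      obtain ⟨t, ht⟩ := nonempty_Ioo.2 hxy
      exact absurd ⟨hx.1.trans ht.1.le, ht.2.le.trans hy.2⟩ (hgap t ht))
  have h2 := logIncrement_planeToComplex' huv hf hC hfC (hgC a (left_mem_Icc.2 hab))
  have h3 := logIncrement_planeToComplex' huv hf hC hfC (hgC b (right_mem_Icc.2 hab))
  unfold crossingNumber
  linear_combination h1 + h2 - h3

/-! ### Excursions into convex sets -/

/-- An excursion of `h` into `V` in the time interval `(u;v)`. -/
structure IsExcursion (h : ℝ → Plane) (V : Set Plane) (u v : ℝ) : Prop where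
  lt : u < v
  left_notMem : h u ∉ V
  right_notMem : h v ∉ V
  mapsTo : MapsTo h (Ioo u v) V

theorem IsExcursion.mapsTo_closure {h : ℝ → Plane} {V : Set Plane} {u v : ℝ}
    (hx : IsExcursion h V u v) (hc : ContinuousOn h (Icc u v)) :
    MapsTo h (Icc u v) (closure V) := by
  have h1 := hx.mapsTo.closure_of_continuousOn (by rwa [closure_Ioo hx.lt.ne])
  rwa [closure_Ioo hx.lt.ne] at h1

/-- An open segment from a point of the closure of a convex open set to a point of the set stays in
the set. -/
theorem notMem_segment_of_mem_closure {V : Set Plane} (hV : IsOpen V) (hconv : Convex ℝ V)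
    {x y z : Plane} (hx : x ∉ V) (hxy : x ≠ y) (hy : y ∈ closure V) (hz : z ∈ V) :
    x ∉ segment ℝ y z := by
  intro h
  have h1 := hconv.openSegment_closure_interior_subset_interior hy (hV.interior_eq.symm ▸ hz)
  rw [hV.interior_eq] at h1
  exact hx (h1 (mem_openSegment_of_ne_left_right hxy.symm (by rintro rfl; exact hx hz) h))

theorem IsExcursion.notMem_segment {h : ℝ → Plane} {V : Set Plane} {u v : ℝ} {x : Plane}
    (he : IsExcursion h V u v) (hc : ContinuousOn h (Icc u v)) (hV : IsOpen V)
    (hconv : Convex ℝ V) (hx : x ∉ V) (hxu : x ≠ h u) (hxs : x ∉ segment ℝ (h u) (h v)) {t : ℝ}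
    (ht : t ∈ Icc u v) : x ∉ segment ℝ (h u) (h t) := by
  rcases ht.1.eq_or_lt with rfl | h1
  · simpa using hxu
  rcases ht.2.eq_or_lt with rfl | h2
  · exact hxs
  exact notMem_segment_of_mem_closure hV hconv hx hxu
    (he.mapsTo_closure hc (left_mem_Icc.2 he.lt.le)) (he.mapsTo ⟨h1, h2⟩)

/-- By convexity, no end point of one excursion ever comes between the starting point and the
current point of the other. So each increment is a principal logarithm, and
`log_quadrilateral_ne_zero` applies. -/
theorem crossingNumber_ne_zero {f g : ℝ → Plane} {V : Set Plane} {u v a b : ℝ} (hV : IsOpen V)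
    (hconv : Convex ℝ V) (hf : ContinuousOn f (Icc u v)) (hg : ContinuousOn g (Icc a b))
    (hfe : IsExcursion f V u v) (hge : IsExcursion g V a b)
    (hne : (segment ℝ (f u) (f v) ∩ segment ℝ (g a) (g b)).Nonempty)
    (hp : f u ∉ segment ℝ (g a) (g b)) (hq : f v ∉ segment ℝ (g a) (g b))
    (h₀ : g a ∉ segment ℝ (f u) (f v)) (h₁ : g b ∉ segment ℝ (f u) (f v)) :
    crossingNumber f g u v a b ≠ 0 := by
  have hl : ∀ {x y z : Plane}, x ∉ segment ℝ y z → x ≠ y := fun h h' =>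
    h (h' ▸ left_mem_segment ℝ _ _)
  unfold crossingNumber
  rw [logIncrement_planeToComplex hge.lt.le hg fun t ht =>
      hge.notMem_segment hg hV hconv hfe.right_notMem (hl hq) hq ht,
    logIncrement_planeToComplex hge.lt.le hg fun t ht =>
      hge.notMem_segment hg hV hconv hfe.left_notMem (hl hp) hp ht,
    logIncrement_planeToComplex hfe.lt.le hf fun t ht =>
      hfe.notMem_segment hf hV hconv hge.right_notMem (hl h₁) h₁ ht,
    logIncrement_planeToComplex hfe.lt.le hf fun t ht =>
      hfe.notMem_segment hf hV hconv hge.left_notMem (hl h₀) h₀ ht]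
  simp only [map_sub]
  refine log_quadrilateral_ne_zero ?_ ?_ ?_ ?_ ?_
  · obtain ⟨x, hx, hx'⟩ := hne
    exact ⟨_, planeToComplex_mem_segment.2 hx, planeToComplex_mem_segment.2 hx'⟩
  all_goals rwa [planeToComplex_mem_segment]

/-- Outside `V`, strict convexity keeps `g` off the chord of `f`; inside `V`, only the chords of the
excursions of `g` matter, and they miss that chord. -/
theorem crossingNumber_eq_zero_of_disjoint {f g : ℝ → Plane} {V : Set Plane} {u v a b : ℝ}
    (hV : IsOpen V) (hconv : Convex ℝ V)
    (hstrict : ∀ x ∈ closure V, ∀ y ∈ closure V, x ≠ y → openSegment ℝ x y ⊆ V)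
    (hab : a ≤ b) (hf : ContinuousOn f (Icc u v)) (hg : ContinuousOn g (Icc a b))
    (hfe : IsExcursion f V u v) (hga : g a ∉ closure V) (hgb : g b ∉ closure V)
    (hp : ∀ t ∈ Icc a b, g t ≠ f u) (hq : ∀ t ∈ Icc a b, g t ≠ f v)
    (hdisj : ∀ a' ∈ Icc a b, ∀ b' ∈ Icc a b, IsExcursion g V a' b' →
      Disjoint (segment ℝ (f u) (f v)) (segment ℝ (g a') (g b'))) :
    crossingNumber f g u v a b = 0 := by
  have hcl := hfe.mapsTo_closure hf
  have h2 := logIncrement_planeToComplex' hfe.lt.le hf hconv.closure hcl hga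
  have h3 := logIncrement_planeToComplex' hfe.lt.le hf hconv.closure hcl hgb
  have hu := hcl (left_mem_Icc.2 hfe.lt.le)
  have hv := hcl (right_mem_Icc.2 hfe.lt.le)
  unfold crossingNumber
  -- Strict convexity says nothing about a degenerate chord, but then the terms cancel directly.
  by_cases huv : f u = f v
  · rw [h2, h3, ← huv, div_self, div_self, Complex.log_one] <;> [ring; skip; skip]
    · exact planeToComplex_sub_ne_zero fun h => hga (h ▸ hu)
    · exact planeToComplex_sub_ne_zero fun h => hgb (h ▸ hu)
  -- The gaps of the set of times when `g` is outside `V` are exactly its excursions into `V`.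
  have hT : IsClosed (Icc a b ∩ g ⁻¹' Vᶜ) := hg.preimage_isClosed_of_isClosed isClosed_Icc
    hV.isClosed_compl
  have h1 := logIncrement_sub_logIncrement (p := f u) (q := f v) hg hp hq hT inter_subset_left
    ⟨left_mem_Icc.2 hab, fun h => hga (subset_closure h)⟩
    ⟨right_mem_Icc.2 hab, fun h => hgb (subset_closure h)⟩ ?_ ?_
  · linear_combination h1 + h2 - h3
  · intro t ht h
    exact ht.2 (hstrict _ hu _ hv huv
      (mem_openSegment_of_ne_left_right (hp t ht.1).symm (hq t ht.1).symm h))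
  · intro x hx y hy hxy hgap
    have he : IsExcursion g V x y := ⟨hxy, hx.2, hy.2, fun t ht => by
      by_contra hn
      exact hgap t ht ⟨⟨hx.1.1.trans ht.1.le, ht.2.le.trans hy.1.2⟩, hn⟩⟩
    have hd := hdisj x hx.1 y hy.1 he
    have hc := hg.mono (Icc_subset_Icc hx.1.1 hy.1.2)
    refine ⟨fun t ht => ?_, fun t ht => ?_, hd⟩
    · exact he.notMem_segment hc hV hconv hfe.left_notMem (hp x hx.1).symm
        (Set.disjoint_left.1 hd (left_mem_segment ℝ _ _)) ht
    · exact he.notMem_segment hc hV hconv hfe.right_notMem (hq x hx.1).symm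
        (Set.disjoint_left.1 hd (right_mem_segment ℝ _ _)) ht

/-! ### Excursions as longest visit intervals -/

theorem IsExcursion.visitInterval_eq {h : ℝ → Plane} {V : Set Plane} {u v c : ℝ}
    (he : IsExcursion h V u v) (hu : 0 ≤ u) (hv : v ≤ 1) (hc : c ∈ Ioo u v) :
    visitInterval h V c = Ioo u v := by
  refine Subset.antisymm (sUnion_subset ?_) (subset_sUnion_of_mem ⟨⟨u, v, rfl⟩,
    fun t ht => ⟨hu.trans ht.1.le, ht.2.le.trans hv⟩, hc, he.mapsTo⟩)
  rintro _ ⟨⟨u', v', rfl⟩, -, hc', hm⟩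
  refine Ioo_subset_Ioo ?_ ?_
  · by_contra! hlt
    exact he.left_notMem (hm ⟨hlt, hc.1.trans hc'.2⟩)
  · by_contra! hlt
    exact he.right_notMem (hm ⟨hc'.1.trans hc.2, hlt⟩)

theorem IsExcursion.entryTime_eq {h : ℝ → Plane} {V : Set Plane} {u v c : ℝ}
    (he : IsExcursion h V u v) (hu : 0 ≤ u) (hv : v ≤ 1) (hc : c ∈ Ioo u v) :
    entryTime h V c = u := by
  rw [entryTime, he.visitInterval_eq hu hv hc, csInf_Ioo he.lt]

theorem IsExcursion.exitTime_eq {h : ℝ → Plane} {V : Set Plane} {u v c : ℝ}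
    (he : IsExcursion h V u v) (hu : 0 ≤ u) (hv : v ≤ 1) (hc : c ∈ Ioo u v) :
    exitTime h V c = v := by
  rw [exitTime, he.visitInterval_eq hu hv hc, csSup_Ioo he.lt]

theorem exists_isExcursion {h : ℝ → Plane} {V : Set Plane} {c : ℝ} (hV : IsOpen V)
    (hh : ContinuousOn h (Icc 0 1)) (h0 : h 0 ∉ V) (h1 : h 1 ∉ V) (hc : c ∈ Icc (0 : ℝ) 1)
    (hcV : h c ∈ V) : ∃ u v, IsExcursion h V u v ∧ 0 ≤ u ∧ v ≤ 1 ∧ c ∈ Ioo u v := by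
  have hT : IsClosed (Icc 0 1 ∩ h ⁻¹' Vᶜ) := hh.preimage_isClosed_of_isClosed isClosed_Icc
    hV.isClosed_compl
  set T := Icc 0 1 ∩ h ⁻¹' Vᶜ
  have hub : BddAbove (T ∩ Iic c) := ⟨c, fun t ht => ht.2⟩
  have hlb : BddBelow (T ∩ Ici c) := ⟨c, fun t ht => ht.2⟩
  have hu := (hT.inter isClosed_Iic).csSup_mem (s := T ∩ Iic c)
    ⟨0, ⟨⟨le_rfl, zero_le_one⟩, h0⟩, hc.1⟩ hub
  have hv := (hT.inter isClosed_Ici).csInf_mem (s := T ∩ Ici c)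
    ⟨1, ⟨⟨zero_le_one, le_rfl⟩, h1⟩, hc.2⟩ hlb
  have hne : ∀ t ∈ T, t ≠ c := fun t ht h => ht.2 (h ▸ hcV)
  have hc' : c ∈ Ioo (sSup (T ∩ Iic c)) (sInf (T ∩ Ici c)) :=
    ⟨lt_of_le_of_ne hu.2 (hne _ hu.1), lt_of_le_of_ne hv.2 (hne _ hv.1).symm⟩
  refine ⟨_, _, ⟨hc'.1.trans hc'.2, hu.1.2, hv.1.2, fun t ht => ?_⟩, hu.1.1.1, hv.1.1.2, hc'⟩
  by_contra hn
  have htT : t ∈ T := ⟨⟨hu.1.1.1.trans ht.1.le, ht.2.le.trans hv.1.1.2⟩, hn⟩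
  rcases le_total t c with htc | htc
  · exact absurd (le_csSup hub ⟨htT, htc⟩) (not_le.2 ht.1)
  · exact absurd (csInf_le hlb ⟨htT, htc⟩) (not_le.2 ht.2)

theorem isExcursion_entryTime_exitTime {h : ℝ → Plane} {V : Set Plane} {c : ℝ} (hV : IsOpen V)
    (hh : ContinuousOn h (Icc 0 1)) (h0 : h 0 ∉ V) (h1 : h 1 ∉ V) (hc : c ∈ Icc (0 : ℝ) 1)
    (hcV : h c ∈ V) : IsExcursion h V (entryTime h V c) (exitTime h V c) ∧
      0 ≤ entryTime h V c ∧ exitTime h V c ≤ 1 ∧ c ∈ Ioo (entryTime h V c) (exitTime h V c) := by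
  obtain ⟨u, v, he, hu, hv, hcuv⟩ := exists_isExcursion hV hh h0 h1 hc hcV
  rw [he.entryTime_eq hu hv hcuv, he.exitTime_eq hu hv hcuv]
  exact ⟨he, hu, hv, hcuv⟩

/-! ### Chains of overlapping intervals -/

/-- If a family of open intervals covers `[s;t]`, and a function takes the same value at the end
points of each interval of the family and at the end points of the intersection of any two of them
that overlap, then it takes the same value at two points before `s` and after `t`. -/
theorem exists_eq_of_cover {α : Type*} {w : ℝ → α} {s t : ℝ} (hst : s ≤ t) {F : Set (ℝ × ℝ)}
    (hcov : ∀ y ∈ Icc s t, ∃ i ∈ F, y ∈ Ioo i.1 i.2) (hw : ∀ i ∈ F, w i.1 = w i.2)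
    (hov : ∀ i ∈ F, ∀ j ∈ F, i.1 < j.1 → j.1 < i.2 → i.2 < j.2 → w j.1 = w i.2) :
    ∃ i ∈ F, ∃ j ∈ F, s ∈ Ioo i.1 i.2 ∧ t ∈ Ioo j.1 j.2 ∧ w i.1 = w j.2 := by
  obtain ⟨K, hKF, hKfin, hK⟩ := isCompact_Icc.elim_finite_subcover_image
    (b := F) (c := fun i : ℝ × ℝ => Ioo i.1 i.2) (fun i _ => isOpen_Ioo)
    fun y hy => by
      obtain ⟨i, hi, hyi⟩ := hcov y hy
      exact mem_iUnion₂.2 ⟨i, hi, hyi⟩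
  have hKc : ∀ y ∈ Icc s t, ∃ i ∈ K, y ∈ Ioo i.1 i.2 := fun y hy => by
    obtain ⟨i, hi, hyi⟩ := mem_iUnion₂.1 (hK hy)
    exact ⟨i, hi, hyi⟩
  have hmax : ∀ y ∈ Icc s t, ∃ i ∈ K, y ∈ Ioo i.1 i.2 ∧ ∀ j ∈ K, y ∈ Ioo j.1 j.2 → j.2 ≤ i.2 := by
    intro y hy
    obtain ⟨i, hi, hi'⟩ := Set.exists_max_image (K ∩ {i | y ∈ Ioo i.1 i.2}) Prod.snd
      (hKfin.inter_of_left _) (by obtain ⟨i, hi⟩ := hKc y hy; exact ⟨i, hi⟩)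
    exact ⟨i, hi.1, hi.2, fun j hj hyj => hi' j ⟨hj, hyj⟩⟩
  obtain ⟨i₀, hi₀, hsi₀, hi₀max⟩ := hmax s (left_mem_Icc.2 hst)
  -- `R` collects the intervals which the initial value of `w` has reached and which extend furthest
  -- to the right among those through some point `y`. This maximality forces the next interval,
  -- through `i.2`, to begin after `i.1`, so that `hov` applies.
  set R : Set (ℝ × ℝ) := {i | i ∈ K ∧ w i.1 = w i₀.1 ∧
    ∃ y ∈ Icc s t, y ∈ Ioo i.1 i.2 ∧ ∀ j ∈ K, y ∈ Ioo j.1 j.2 → j.2 ≤ i.2}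
  obtain ⟨i, ⟨hiK, hwi, y, hy, hyi, hyi'⟩, hi⟩ := Set.exists_max_image R Prod.snd
    (hKfin.subset fun i hi => hi.1) ⟨i₀, hi₀, rfl, s, left_mem_Icc.2 hst, hsi₀, hi₀max⟩
  rcases lt_or_ge t i.2 with hti | hti
  · exact ⟨i₀, hKF hi₀, i, hKF hiK, hsi₀, ⟨hyi.1.trans_le hy.2, hti⟩,
      hwi.symm.trans (hw i (hKF hiK))⟩
  exfalso
  have hi2 : i.2 ∈ Icc s t := ⟨hy.1.trans hyi.2.le, hti⟩
  obtain ⟨j, hjK, hij, hj⟩ := hmax _ hi2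
  have hlt : i.1 < j.1 := by
    by_contra! hle
    exact absurd (hyi' j hjK ⟨hle.trans_lt hyi.1, hyi.2.trans hij.2⟩) (not_le.2 hij.2)
  have hwj := hov i (hKF hiK) j (hKF hjK) hlt hij.1 hij.2
  refine absurd (hi j ⟨hjK, ?_, i.2, hi2, hij, hj⟩) (not_le.2 hij.2)
  rw [hwj, ← hw i (hKF hiK), hwi]

/-! ### The square, balls and lenses -/

theorem isOpen_openSquare : IsOpen openSquare := by
  have : openSquare = ⋂ i : Fin 2, (fun x : Plane => x i) ⁻¹' Ioo (0 : ℝ) 1 := by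
    ext x; simp [openSquare]
  rw [this]
  exact isOpen_iInter_of_finite fun i => isOpen_Ioo.preimage (by fun_prop)

theorem convex_openSquare : Convex ℝ openSquare := by
  intro x hx y hy a b ha hb hab i
  exact convex_Ioo (0 : ℝ) 1 (hx i) (hy i) ha hb hab

theorem isBounded_openSquare : Bornology.IsBounded openSquare := by
  rw [isBounded_iff_forall_norm_le]
  refine ⟨2, fun x hx => ?_⟩
  rw [EuclideanSpace.norm_eq, Real.sqrt_le_left (by norm_num), Fin.sum_univ_two]
  have h0 := hx 0
  have h1 := hx 1
  simp only [Real.norm_eq_abs, sq_abs]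
  nlinarith [h0.1, h0.2, h1.1, h1.2]

/-- An open convex set without segments in its boundary. -/
structure IsStrictlyConvexOpen (V : Set Plane) : Prop where
  isOpen : IsOpen V
  convex : Convex ℝ V
  openSegment_subset : ∀ x ∈ closure V, ∀ y ∈ closure V, x ≠ y → openSegment ℝ x y ⊆ V

theorem IsPathBall.isStrictlyConvexOpen {f : ℝ → Plane} {V : Set Plane} (h : IsPathBall f V) :
    IsStrictlyConvexOpen V := by
  obtain ⟨a, r, -, hr, -, rfl⟩ := h
  have hr' : (r : ℝ) ≠ 0 := by exact_mod_cast hr.ne'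
  refine ⟨Metric.isOpen_ball, convex_ball _ _, fun x hx y hy hxy => ?_⟩
  rw [closure_ball _ hr'] at hx hy
  have := (strictConvex_closedBall ℝ (f a) (r : ℝ)).openSegment_subset hx hy hxy
  rwa [interior_closedBall _ hr'] at this

theorem IsPathLens.isStrictlyConvexOpen {f : ℝ → Plane} {V : Set Plane} (h : IsPathLens f V) :
    IsStrictlyConvexOpen V := by
  obtain ⟨B₁, B₂, h₁, h₂, -, -, -, rfl⟩ := h
  have h₁ := h₁.isStrictlyConvexOpen
  have h₂ := h₂.isStrictlyConvexOpen
  refine ⟨h₁.isOpen.inter h₂.isOpen, h₁.convex.inter h₂.convex, fun x hx y hy hxy =>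
    subset_inter ?_ ?_⟩
  · exact h₁.openSegment_subset _ (closure_mono inter_subset_left hx) _
      (closure_mono inter_subset_left hy) hxy
  · exact h₂.openSegment_subset _ (closure_mono inter_subset_right hx) _
      (closure_mono inter_subset_right hy) hxy

theorem IsPathBall.subset_openSquare {f : ℝ → Plane} {V : Set Plane} (h : IsPathBall f V) :
    V ⊆ openSquare := by
  obtain ⟨a, r, -, -, hs, rfl⟩ := h
  exact subset_closure.trans hs

theorem IsPathLens.subset_openSquare {f : ℝ → Plane} {V : Set Plane} (h : IsPathLens f V) :
    V ⊆ openSquare := by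
  obtain ⟨B₁, B₂, h₁, -, -, -, -, rfl⟩ := h
  exact inter_subset_left.trans h₁.subset_openSquare

theorem IsStrictlyConvexOpen.notMem_segment {V : Set Plane} (hV : IsStrictlyConvexOpen V)
    {x y z : Plane} (hx : x ∉ V) (hy : y ∈ closure V) (hz : z ∈ closure V) (hxy : x ≠ y)
    (hxz : x ≠ z) : x ∉ segment ℝ y z := by
  intro h
  by_cases hyz : y = z
  · rw [hyz, segment_same] at h
    exact hxz h
  · exact hx (hV.openSegment_subset y hy z hz hyz
      (mem_openSegment_of_ne_left_right hxy.symm hxz.symm h))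

theorem zero_zero_notMem_openSquare : (!₂[0, 0] : Plane) ∉ openSquare := fun h => by
  simpa using (h 0).1

theorem one_one_notMem_openSquare : (!₂[1, 1] : Plane) ∉ openSquare := fun h => by
  simpa using (h 0).2

theorem zero_one_notMem_openSquare : (!₂[0, 1] : Plane) ∉ openSquare := fun h => by
  simpa using (h 0).1

theorem one_zero_notMem_openSquare : (!₂[1, 0] : Plane) ∉ openSquare := fun h => by
  simpa using (h 0).2

theorem IsSquarePath.isExcursion {h : ℝ → Plane} {x y : Plane} (hh : IsSquarePath h x y)
    (hx : x ∉ openSquare) (hy : y ∉ openSquare) : IsExcursion h openSquare 0 1 :=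
  ⟨zero_lt_one, by rwa [hh.start_eq], by rwa [hh.end_eq], hh.mem_openSquare⟩

theorem notMem_segment_diagonals :
    ((!₂[0, 0] : Plane) ∉ segment ℝ !₂[0, 1] !₂[1, 0]) ∧
    ((!₂[1, 1] : Plane) ∉ segment ℝ !₂[0, 1] !₂[1, 0]) ∧
    ((!₂[0, 1] : Plane) ∉ segment ℝ !₂[0, 0] !₂[1, 1]) ∧
    ((!₂[1, 0] : Plane) ∉ segment ℝ !₂[0, 0] !₂[1, 1]) := by
  refine ⟨?_, ?_, ?_, ?_⟩ <;>
  · rintro ⟨a, b, -, -, hab, h⟩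
    have h0 := congrFun (congrArg WithLp.ofLp h) 0
    have h1 := congrFun (congrArg WithLp.ofLp h) 1
    simp at h0 h1
    linarith

/-! ### Small excursions with ends off `g` -/

theorem IsCompact.exists_ball_disjoint {K : Set Plane} (hK : IsCompact K) {x : Plane}
    (hx : x ∉ K) : ∃ ρ > 0, ∀ y ∈ K, y ∉ Metric.ball x ρ := by
  obtain ⟨ρ, hρ, h⟩ := Metric.isOpen_iff.1 hK.isClosed.isOpen_compl x hx
  exact ⟨ρ, hρ, fun y hy hy' => h hy' hy⟩

theorem isCompact_pathRange {g : ℝ → Plane} (hg : ContinuousOn g (Icc 0 1)) :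
    IsCompact (pathRange g) := isCompact_Icc.image_of_continuousOn hg

/-- If `Q` fails, then each point of `f` is in small balls whose boundary `f` crosses away
from `g`. -/
theorem exists_isPathBall_isExcursion {f g : ℝ → Plane} (hf : ContinuousOn f (Icc 0 1))
    (h0 : f 0 ∉ openSquare) (h1 : f 1 ∉ openSquare) (hQ : ¬ QPredicate f g)
    {W : Set Plane} (hW : IsOpen W) (hWs : W ⊆ openSquare) {s : ℝ} (hs : s ∈ Ioo (0 : ℝ) 1)
    (hsW : f s ∈ W) {ε : ℝ} (hε : 0 < ε) :
    ∃ B u v, IsPathBall f B ∧ closure B ⊆ W ∧ Metric.diam B < ε ∧ IsExcursion f B u v ∧ 0 ≤ u ∧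
      v ≤ 1 ∧ s ∈ Ioo u v ∧ f u ∉ pathRange g ∧ f v ∉ pathRange g := by
  obtain ⟨η₀, hη₀, hball⟩ := Metric.isOpen_iff.1 hW _ hsW
  obtain ⟨η, hη, hηη, hηε⟩ : ∃ η > 0, η < η₀ ∧ η < ε / 2 :=
    ⟨min η₀ (ε / 2) / 2, by positivity, by have := min_le_left η₀ (ε / 2); linarith,
      by have := min_le_right η₀ (ε / 2); linarith⟩
  have hcont : ContinuousAt f s := hf.continuousAt (Icc_mem_nhds hs.1 hs.2)
  obtain ⟨δ, hδ, hδf⟩ := Metric.continuousAt_iff.1 hcont (η / 4) (by positivity)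
  obtain ⟨a, hsa, ha⟩ := exists_rat_btwn (show s < min 1 (s + δ) from lt_min hs.2 (by linarith))
  have ha01 : (a : ℝ) ∈ Ioo (0 : ℝ) 1 := ⟨hs.1.trans hsa, ha.trans_le (min_le_left _ _)⟩
  have haδ : (a : ℝ) < s + δ := ha.trans_le (min_le_right _ _)
  have hnear : ∀ t ∈ Icc s a, dist (f t) (f s) < η / 4 := fun t ht => hδf (by
    rw [Real.dist_eq, abs_lt]; constructor <;> linarith [ht.1, ht.2])
  have hfa := hnear a ⟨hsa.le, le_rfl⟩
  -- The radii lie between `η / 2` and `3 * η / 4`. This is large enough for `f` to stay in the ball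
  -- from `s` to `a`, and small enough for the closed ball to lie within `η` of `f s`.
  obtain ⟨r₁, hr₁, hr₁'⟩ := exists_rat_btwn (show η / 2 < 5 * η / 8 by linarith)
  obtain ⟨r₂, hr₂, hr₂'⟩ := exists_rat_btwn (show 5 * η / 8 < 3 * η / 4 by linarith)
  have hcl : Metric.closedBall (f a) r₂ ⊆ W := fun y hy => hball (by
    rw [Metric.mem_closedBall] at hy
    rw [Metric.mem_ball]
    linarith [dist_triangle y (f a) (f s)])
  have hclb : ∀ r : ℝ, r ≤ r₂ → closure (Metric.ball (f a) r) ⊆ W := fun r hr =>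
    Metric.closure_ball_subset_closedBall.trans ((Metric.closedBall_subset_closedBall hr).trans hcl)
  unfold QPredicate at hQ
  push Not at hQ
  obtain ⟨t, ht₁, ht₂, hu, hv⟩ := hQ a r₁ r₂ ha01 (by
      have : (0 : ℝ) < r₁ := by linarith
      exact_mod_cast this) (by
      have : (r₁ : ℝ) < r₂ := by linarith
      exact_mod_cast this) ((hclb r₂ le_rfl).trans hWs)
  have ht₁' : (r₁ : ℝ) ≤ t := by exact_mod_cast ht₁
  have ht₂' : (t : ℝ) ≤ r₂ := by exact_mod_cast ht₂
  have htpos : (0 : ℝ) < t := by linarith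
  have hBW := hclb t ht₂'
  have hBs : Metric.ball (f a) (t : ℝ) ⊆ openSquare := (subset_closure.trans hBW).trans hWs
  obtain ⟨he, hu0, hv1, hauv⟩ := isExcursion_entryTime_exitTime (h := f) (c := a)
    (Metric.isOpen_ball (x := f a) (ε := (t : ℝ))) hf (fun h => h0 (hBs h)) (fun h => h1 (hBs h))
    ⟨ha01.1.le, ha01.2.le⟩ (Metric.mem_ball_self htpos)
  refine ⟨_, _, _, ⟨a, t, ha01, by exact_mod_cast htpos, hBW.trans hWs, rfl⟩, hBW, ?_, he, hu0,
    hv1, ⟨?_, hsa.trans hauv.2⟩, hu, hv⟩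
  · refine (Metric.diam_ball htpos.le).trans_lt ?_
    linarith
  · by_contra! hle
    refine he.left_notMem ?_
    rw [Metric.mem_ball]
    linarith [hnear _ ⟨hle, hauv.1.le⟩, dist_triangle_right
      (f (entryTime f (Metric.ball (f a) (t : ℝ)) a)) (f a) (f s)]

/-- This is why lenses are needed: the overlap of two excursions into balls inherits one end from
each, so its ends are off `g` if theirs are. -/
theorem IsExcursion.inter {f : ℝ → Plane} {B₁ B₂ : Set Plane} {u₁ v₁ u₂ v₂ : ℝ}
    (h₁ : IsExcursion f B₁ u₁ v₁) (h₂ : IsExcursion f B₂ u₂ v₂) (hu : u₁ < u₂) (huv : u₂ < v₁)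
    (hv : v₁ < v₂) : IsExcursion f (B₁ ∩ B₂) u₂ v₁ :=
  ⟨huv, fun h => h₂.left_notMem h.2, fun h => h₁.right_notMem h.1, fun _ ht =>
    ⟨h₁.mapsTo ⟨hu.trans ht.1, ht.2⟩, h₂.mapsTo ⟨ht.1, ht.2.trans hv⟩⟩⟩

theorem IsPathBall.isPathLens_inter {f : ℝ → Plane} {B₁ B₂ : Set Plane} {u₁ v₁ u₂ v₂ : ℝ}
    (hB₁ : IsPathBall f B₁) (hB₂ : IsPathBall f B₂)
    (h₁ : IsExcursion f B₁ u₁ v₁) (h₂ : IsExcursion f B₂ u₂ v₂) (hu : u₁ < u₂) (huv : u₂ < v₁)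
    (hv : v₁ < v₂) : IsPathLens f (B₁ ∩ B₂) := by
  refine ⟨B₁, B₂, hB₁, hB₂, fun h => h₂.left_notMem (h (h₁.mapsTo ⟨hu, huv⟩)),
    fun h => h₁.right_notMem (h (h₂.mapsTo ⟨huv, hv⟩)), ?_, rfl⟩
  obtain ⟨t, ht⟩ := nonempty_Ioo.2 huv
  exact ⟨f t, (h₁.inter h₂ hu huv hv).mapsTo ht⟩

/-- An excursion of `f` into a ball or lens that is not crossed by `g` contributes nothing to the
crossings with an excursion of `g` into a larger set. -/
theorem crossingNumber_eq_zero_of_not_isCrossed {f g : ℝ → Plane} {B V : Set Plane}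
    {u v j₀ j₁ : ℝ} (hf : ContinuousOn f (Icc 0 1)) (hg : ContinuousOn g (Icc 0 1))
    (hB : IsPathBall f B ∨ IsPathLens f B) (hBV : closure B ⊆ V) (he : IsExcursion f B u v)
    (hu0 : 0 ≤ u) (hv1 : v ≤ 1) (hu : f u ∉ pathRange g) (hv : f v ∉ pathRange g)
    (hj : IsExcursion g V j₀ j₁) (hj0 : 0 ≤ j₀) (hj1 : j₁ ≤ 1)
    (hno : ∀ c : ℚ, IsGate f g B c → ¬ IsCrossed f g B c) :
    crossingNumber f g u v j₀ j₁ = 0 := by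
  have hBc : IsStrictlyConvexOpen B := hB.elim (·.isStrictlyConvexOpen) (·.isStrictlyConvexOpen)
  obtain ⟨c, hcu, hcv⟩ := exists_rat_btwn he.lt
  have hc : (c : ℝ) ∈ Ioo u v := ⟨hcu, hcv⟩
  have hen := he.entryTime_eq hu0 hv1 hc
  have hex := he.exitTime_eq hu0 hv1 hc
  have hgate : IsGate f g B c := by
    refine ⟨⟨Or.inr hB, ⟨hu0.trans_lt hcu, hcv.trans_le hv1⟩, he.mapsTo hc⟩, ?_, ?_⟩
    · rwa [hen]
    · rwa [hex]
  have hsub : Icc j₀ j₁ ⊆ Icc 0 1 := Icc_subset_Icc hj0 hj1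
  refine crossingNumber_eq_zero_of_disjoint hBc.isOpen hBc.convex hBc.openSegment_subset hj.lt.le
    (hf.mono (Icc_subset_Icc hu0 hv1)) (hg.mono hsub) he (fun h => hj.left_notMem (hBV h))
    (fun h => hj.right_notMem (hBV h)) (fun t ht h => hu ⟨t, hsub ht, h⟩)
    (fun t ht h => hv ⟨t, hsub ht, h⟩) fun a ha b hb hab => ?_
  -- A rational time inside the excursion of `g` turns intersecting chords into a crossing of the
  -- gate.
  obtain ⟨d, hda, hdb⟩ := exists_rat_btwn hab.lt
  have hd : (d : ℝ) ∈ Ioo a b := ⟨hda, hdb⟩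
  have ha0 := (hsub ha).1
  have hb1 := (hsub hb).2
  rw [Set.disjoint_iff_inter_eq_empty, ← Set.not_nonempty_iff_eq_empty]
  intro hne
  refine hno c hgate ⟨d, ⟨ha0.trans hda.le, hdb.le.trans hb1⟩, hab.mapsTo hd, ?_⟩
  rwa [hen, hex, hab.entryTime_eq ha0 hb1 hd, hab.exitTime_eq ha0 hb1 hd]

/-! ### Passages and general position -/

theorem IsPassage.isOpen {f : ℝ → Plane} {V : Set Plane} {c : ℚ} (h : IsPassage f V c) :
    IsOpen V := by
  rcases h.shape with rfl | h | h
  · exact isOpen_openSquare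
  · exact h.isStrictlyConvexOpen.isOpen
  · exact h.isStrictlyConvexOpen.isOpen

theorem IsPassage.convex {f : ℝ → Plane} {V : Set Plane} {c : ℚ} (h : IsPassage f V c) :
    Convex ℝ V := by
  rcases h.shape with rfl | h | h
  · exact convex_openSquare
  · exact h.isStrictlyConvexOpen.convex
  · exact h.isStrictlyConvexOpen.convex

theorem IsPassage.subset_openSquare {f : ℝ → Plane} {V : Set Plane} {c : ℚ}
    (h : IsPassage f V c) : V ⊆ openSquare := by
  rcases h.shape with rfl | h | h
  · exact Subset.rfl
  · exact h.subset_openSquare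
  · exact h.subset_openSquare

theorem IsPassage.diam_pos {f : ℝ → Plane} {V : Set Plane} {c : ℚ} (h : IsPassage f V c) :
    0 < Metric.diam V :=
  Metric.diam_pos (infinite_of_mem_nhds _ (h.isOpen.mem_nhds h.mem)).nontrivial
    (isBounded_openSquare.subset h.subset_openSquare)

/-- The end points of an excursion of `f` through a gate and of one of `g` are in general
position. -/
theorem IsPassage.notMem_segment {f g : ℝ → Plane} (hf : IsSquarePath f !₂[0, 0] !₂[1, 1])
    (hg : IsSquarePath g !₂[0, 1] !₂[1, 0]) {V : Set Plane} {c : ℚ} (hV : IsPassage f V c)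
    {u v a b : ℝ} (hc : (c : ℝ) ∈ Ioo u v) (hfe : IsExcursion f V u v) (hu : 0 ≤ u) (hv : v ≤ 1)
    (hge : IsExcursion g V a b) (ha : 0 ≤ a) (hb : b ≤ 1) (hgu : f u ∉ pathRange g)
    (hgv : f v ∉ pathRange g) :
    f u ∉ segment ℝ (g a) (g b) ∧ f v ∉ segment ℝ (g a) (g b) ∧
      g a ∉ segment ℝ (f u) (f v) ∧ g b ∉ segment ℝ (f u) (f v) := by
  have hab := hge.lt.le
  -- The square is not strictly convex, but there the excursions are the whole paths and their ends
  -- are the corners.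
  by_cases hsq : V = openSquare
  · subst hsq
    have hf1 := hf.isExcursion zero_zero_notMem_openSquare one_one_notMem_openSquare
    have hg1 := hg.isExcursion zero_one_notMem_openSquare one_zero_notMem_openSquare
    have hc01 : (c : ℝ) ∈ Ioo (0 : ℝ) 1 := ⟨hu.trans_lt hc.1, hc.2.trans_le hv⟩
    have hd : (a + b) / 2 ∈ Ioo a b := by constructor <;> linarith [hge.lt]
    have hd01 : (a + b) / 2 ∈ Ioo (0 : ℝ) 1 := ⟨ha.trans_lt hd.1, hd.2.trans_le hb⟩
    rw [(hfe.entryTime_eq hu hv hc).symm.trans (hf1.entryTime_eq le_rfl le_rfl hc01),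
      (hfe.exitTime_eq hu hv hc).symm.trans (hf1.exitTime_eq le_rfl le_rfl hc01),
      (hge.entryTime_eq ha hb hd).symm.trans (hg1.entryTime_eq le_rfl le_rfl hd01),
      (hge.exitTime_eq ha hb hd).symm.trans (hg1.exitTime_eq le_rfl le_rfl hd01),
      hf.start_eq, hf.end_eq, hg.start_eq, hg.end_eq]
    exact notMem_segment_diagonals
  · have hs : IsStrictlyConvexOpen V := by
      rcases hV.shape with h | h | h
      · exact absurd h hsq
      · exact h.isStrictlyConvexOpen
      · exact h.isStrictlyConvexOpen
    have hcf := hfe.mapsTo_closure (hf.continuousOn.mono (Icc_subset_Icc hu hv))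
    have hcg := hge.mapsTo_closure (hg.continuousOn.mono (Icc_subset_Icc ha hb))
    have hfu := hcf (left_mem_Icc.2 hfe.lt.le)
    have hfv := hcf (right_mem_Icc.2 hfe.lt.le)
    have hga := hcg (left_mem_Icc.2 hab)
    have hgb := hcg (right_mem_Icc.2 hab)
    have hae : g a ∈ pathRange g := ⟨a, ⟨ha, hab.trans hb⟩, rfl⟩
    have hbe : g b ∈ pathRange g := ⟨b, ⟨ha.trans hab, hb⟩, rfl⟩
    have hne : ∀ {x y}, x ∉ pathRange g → y ∈ pathRange g → x ≠ y := fun h h' e => h (e ▸ h')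
    exact ⟨hs.notMem_segment hfe.left_notMem hga hgb (hne hgu hae) (hne hgu hbe),
      hs.notMem_segment hfe.right_notMem hga hgb (hne hgv hae) (hne hgv hbe),
      hs.notMem_segment hge.left_notMem hfu hfv (hne hgu hae).symm (hne hgv hae).symm,
      hs.notMem_segment hge.right_notMem hfu hfv (hne hgu hbe).symm (hne hgv hbe).symm⟩

/-! ### The smaller crossed gate -/

theorem lemma2 (f g : ℝ → Plane)
    (hf : IsSquarePath f !₂[0, 0] !₂[1, 1])
    (hg : IsSquarePath g !₂[0, 1] !₂[1, 0])
    (hQ : ¬ QPredicate f g)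
    (V : Set Plane) (c : ℚ) (hV : IsGate f g V c) (hc : IsCrossed f g V c) :
    ∃ (V' : Set Plane) (c' : ℚ), IsGate f g V' c' ∧ IsCrossed f g V' c' ∧
      closure V' ⊆ V ∧ Metric.diam V' < Metric.diam V / 2 := by
  by_contra hno
  have hno' : ∀ B : Set Plane, closure B ⊆ V → Metric.diam B < Metric.diam V / 2 →
      ∀ c' : ℚ, IsGate f g B c' → ¬ IsCrossed f g B c' :=
    fun B h₁ h₂ c' h₃ h₄ => hno ⟨B, c', h₃, h₄, h₁, h₂⟩
  have hP := hV.isPassage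
  have hVs := hP.subset_openSquare
  have hVo := hP.isOpen
  have hf0 : f 0 ∉ openSquare := hf.start_eq ▸ zero_zero_notMem_openSquare
  have hf1 : f 1 ∉ openSquare := hf.end_eq ▸ one_one_notMem_openSquare
  have hg0 : g 0 ∉ openSquare := hg.start_eq ▸ zero_one_notMem_openSquare
  have hg1 : g 1 ∉ openSquare := hg.end_eq ▸ one_zero_notMem_openSquare
  obtain ⟨d, hd, hdV, hcross⟩ := hc
  obtain ⟨hfe, he0, hx1, hcI⟩ := isExcursion_entryTime_exitTime hVo hf.continuousOn
    (fun h => hf0 (hVs h)) (fun h => hf1 (hVs h)) ⟨hP.time_mem.1.le, hP.time_mem.2.le⟩ hP.mem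
  obtain ⟨hge, hj0, hj1, -⟩ := isExcursion_entryTime_exitTime hVo hg.continuousOn
    (fun h => hg0 (hVs h)) (fun h => hg1 (hVs h)) hd hdV
  have hen := hV.entry_notMem
  have hex := hV.exit_notMem
  set e := entryTime f V c
  set x := exitTime f V c
  set j₀ := entryTime g V d
  set j₁ := exitTime g V d
  have hfex : Icc e x ⊆ Icc 0 1 := Icc_subset_Icc he0 hx1
  have hgj : Icc j₀ j₁ ⊆ Icc 0 1 := Icc_subset_Icc hj0 hj1
  obtain ⟨h₁, h₂, h₃, h₄⟩ := IsPassage.notMem_segment hf hg hP hcI hfe he0 hx1 hge hj0 hj1 hen hex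
  refine crossingNumber_ne_zero hVo hP.convex (hf.continuousOn.mono hfex) (hg.continuousOn.mono hgj)
    hfe hge hcross h₁ h₂ h₃ h₄ ?_
  -- the crossing number as a function of the end point is additive
  have hfj : ∀ y ∈ pathRange g, y ∉ V → ∀ s ∈ Icc e x, f s ≠ y := by
    intro y hy hyV s hs h
    rcases hs.1.eq_or_lt with rfl | h1
    · exact hen (h ▸ hy)
    rcases hs.2.eq_or_lt with rfl | h2
    · exact hex (h ▸ hy)
    exact hyV (h ▸ hfe.mapsTo ⟨h1, h2⟩)
  have hfj0 := hfj (g j₀) ⟨j₀, hgj (left_mem_Icc.2 hge.lt.le), rfl⟩ hge.left_notMem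
  have hfj1 := hfj (g j₁) ⟨j₁, hgj (right_mem_Icc.2 hge.lt.le), rfl⟩ hge.right_notMem
  have hadd : ∀ u v, e ≤ u → u ≤ v → v ≤ x →
      crossingNumber f g e u j₀ j₁ + crossingNumber f g u v j₀ j₁ =
        crossingNumber f g e v j₀ j₁ := fun u v hu huv hv =>
    crossingNumber_add hu huv (hf.continuousOn.mono ((Icc_subset_Icc le_rfl hv).trans hfex))
      (fun s hs => hfj0 s ⟨hs.1, hs.2.trans hv⟩) (fun s hs => hfj1 s ⟨hs.1, hs.2.trans hv⟩)
  -- near the ends of the excursion there are no crossings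
  have hends : ∀ y ∈ Icc e x, f y ∉ pathRange g → ∃ δ > 0, ∀ u v, e ≤ u → u ≤ v → v ≤ x →
      y - δ < u → v < y + δ → crossingNumber f g u v j₀ j₁ = 0 := by
    intro y hy hyg
    -- A disc around `f y` misses the compact range of `g`, and it is convex.
    obtain ⟨ρ, hρ, hball⟩ := (isCompact_pathRange hg.continuousOn).exists_ball_disjoint hyg
    obtain ⟨δ, hδ, hδf⟩ := Metric.continuousWithinAt_iff.1 (hf.continuousOn y (hfex hy)) ρ hρ
    refine ⟨δ, hδ, fun u v hu huv hv hyu hyv => ?_⟩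
    have huvx : Icc u v ⊆ Icc 0 1 := (Icc_subset_Icc hu hv).trans hfex
    refine crossingNumber_eq_zero_of_convex huv hge.lt.le (hf.continuousOn.mono huvx)
      (hg.continuousOn.mono hgj) (convex_ball (f y) ρ) (fun t ht => hδf (huvx ht) ?_)
      fun t ht => hball _ ⟨t, hgj ht, rfl⟩
    rw [Real.dist_eq, abs_lt]
    constructor <;> linarith [ht.1, ht.2]
  obtain ⟨δ₀, hδ₀, hz₀⟩ := hends e (left_mem_Icc.2 hfe.lt.le) hen
  obtain ⟨δ₁, hδ₁, hz₁⟩ := hends x (right_mem_Icc.2 hfe.lt.le) hex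
  have hex' := hfe.lt
  -- The midpoint serves only to guarantee `s₀ ≤ s₁`.
  obtain ⟨s₀, hs₀, hs₀'⟩ := exists_between (show e < min (e + δ₀) ((e + x) / 2) from
    lt_min (by linarith) (by linarith))
  obtain ⟨s₁, hs₁, hs₁'⟩ := exists_between (show max (x - δ₁) ((e + x) / 2) < x from
    max_lt (by linarith) (by linarith))
  rw [lt_min_iff] at hs₀'
  rw [max_lt_iff] at hs₁
  have hs : s₀ ≤ s₁ := by linarith [hs₀'.2, hs₁.2]
  -- small balls cover the excursion
  set F : Set (ℝ × ℝ) := {i | ∃ B, IsPathBall f B ∧ closure B ⊆ V ∧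
    Metric.diam B < Metric.diam V / 2 ∧ IsExcursion f B i.1 i.2 ∧ e < i.1 ∧ i.2 < x ∧
    f i.1 ∉ pathRange g ∧ f i.2 ∉ pathRange g}
  have hcov : ∀ s ∈ Icc s₀ s₁, ∃ i ∈ F, s ∈ Ioo i.1 i.2 := by
    intro s hs
    have hsI : s ∈ Ioo e x := ⟨hs₀.trans_le hs.1, hs.2.trans_lt hs₁'⟩
    obtain ⟨B, u, v, hB, hBV, hBd, he, hu0, hv1, hsuv, hu, hv⟩ :=
      exists_isPathBall_isExcursion hf.continuousOn hf0 hf1 hQ hVo hVs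
        ⟨he0.trans_lt hsI.1, hsI.2.trans_le hx1⟩ (hfe.mapsTo hsI) (half_pos hP.diam_pos)
    have hcl := he.mapsTo_closure (hf.continuousOn.mono (Icc_subset_Icc hu0 hv1))
    refine ⟨(u, v), ⟨B, hB, hBV, hBd, he, ?_, ?_, hu, hv⟩, hsuv⟩
    -- Otherwise `f e` would lie in the closure of `B` and hence in `V`.
    · by_contra! hle
      exact hfe.left_notMem (hBV (hcl ⟨hle, hsI.1.le.trans hsuv.2.le⟩))
    · by_contra! hle
      exact hfe.right_notMem (hBV (hcl ⟨hsuv.1.le.trans hsI.2.le, hle⟩))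
  have hpart : ∀ B u v, (IsPathBall f B ∨ IsPathLens f B) → closure B ⊆ V →
      Metric.diam B < Metric.diam V / 2 → IsExcursion f B u v → e < u → v < x →
      f u ∉ pathRange g → f v ∉ pathRange g →
      crossingNumber f g e u j₀ j₁ = crossingNumber f g e v j₀ j₁ := by
    intro B u v hB hBV hBd he heu hvx hu hv
    rw [← hadd u v heu.le he.lt.le hvx.le, crossingNumber_eq_zero_of_not_isCrossed hf.continuousOn
      hg.continuousOn hB hBV he (he0.trans heu.le) (hvx.le.trans hx1) hu hv hge hj0 hj1
      (hno' B hBV hBd), add_zero]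
  obtain ⟨⟨u, v⟩, ⟨-, -, -, -, -, hu, -⟩, ⟨u', v'⟩, ⟨-, -, -, -, -, -, hv', -⟩, hsi, hsj, hw⟩ :=
    exists_eq_of_cover (w := fun s => crossingNumber f g e s j₀ j₁) hs hcov
      (fun i ⟨B, hB, hBV, hBd, he, heu, hvx, hu, hv⟩ =>
        hpart B _ _ (Or.inl hB) hBV hBd he heu hvx hu hv)
      (fun i ⟨B₁, hB₁, hBV₁, hBd₁, he₁, _, hvx₁, _, hv₁⟩ j
          ⟨B₂, hB₂, _, _, he₂, heu₂, _, hu₂, _⟩ h₁ h₂ h₃ =>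
        hpart (B₁ ∩ B₂) _ _ (Or.inr (hB₁.isPathLens_inter hB₂ he₁ he₂ h₁ h₂ h₃))
          ((closure_mono inter_subset_left).trans hBV₁)
          ((Metric.diam_mono inter_subset_left (isBounded_openSquare.subset
            (hB₁.subset_openSquare))).trans_lt hBd₁)
          (he₁.inter he₂ h₁ h₂ h₃) heu₂ hvx₁ hu₂ hv₁)
  simp only at hw hu hv' hsi hsj
  -- The chain starts before `s₀` and ends after `s₁`, so what remains on either side is within
  -- reach of the discs around `f e` and `f x`.
  have hw1 : crossingNumber f g e u j₀ j₁ = 0 :=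
    hz₀ e u le_rfl hu.le (by linarith [hsi.1, hs₀'.2]) (by linarith)
      (by linarith [hsi.1, hs₀'.1])
  have hw2 : crossingNumber f g v' x j₀ j₁ = 0 :=
    hz₁ v' x (by linarith [hsj.2, hs₁.2]) hv'.le le_rfl (by linarith [hsj.2, hs₁.1])
      (by linarith)
  rw [← hadd v' x (by linarith [hsj.2, hs₁.2]) hv'.le le_rfl, ← hw, hw1, hw2, add_zero]
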